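/- Let $G$ be a (finite-dimensional, real, smooth) Lie group and let $\Lambda\subset G$ be a discrete subgroup such that $G/\Lambda$ is compact (a uniform lattice). Endow $G$ with a smooth Riemannian metric that is invariant under right translations by elements of $\Lambda$, and endow $G/\Lambda$ with the induced Riemannian metric, i.e. the one for which the projection $G\to G/\Lambda$ is a local isometry. Let $d$ be the associated Riemannian distance on $G/\Lambda$ (equal to $\infty$ between points of different connected components): $$d(p,q)=\inf\{d_G(x,y):\ x,y\in G,\ x\Lambda=p,\ y\Lambda=q\}.$$ An endomorphism of $G/\Lambda$ is a map $\phi:G/\Lambda\to G/\Lambda$ of the form $\phi(g\Lambda)=\underline{g}\,\Phi(g)\Lambda$, where $\underline{g}\in G$ and $\Phi:G\to G$ is a morphism of Lie groups (a smooth group homomorphism) with $\Phi(\Lambda)\subset\Lambda$. For $x\in G/\Lambda$, $n\in\mathbb{N}$ and $\varepsilon>0$ let $B_n(\phi,x,\varepsilon)=\{y:\ d(\phi^i y,\phi^i x)<\varepsilon,\ 0\le i<n\}$, and for a subset $S\subset G/\Lambda$ and $\delta>0$ let $r_n(\phi,S,\delta)$ be the smallest cardinality of a set $K\subset G/\Lambda$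 such that for every $x\in S$ there is $y\in K$ with $d(\phi^i x,\phi^i y)<\delta$ for $0\le i<n$. The $\varepsilon$-tail entropy of $\phi$ is $$h^*(\phi,\varepsilon)=\lim_{\delta\to0}\limsup_{n\to\infty}\frac1n\log\sup_{x\in G/\Lambda} r_n\bigl(\phi,B_n(\phi,x,\varepsilon),\delta\bigr),$$ and $\phi$ is called $h$-expansive if $h^*(\phi,\varepsilon)=0$ for some $\varepsilon>0$. Theorem. Every endomorphism $\phi$ of $G/\Lambda$ is $h$-expansive. -/

import Mathlib

open scoped Bundle Manifold ContDiff ENNReal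

/-! ### Bowen's entropy notions with respect to an extended distance -/

section Entropy

variable {X : Type*}

/-- The `n`-step dynamical ball
`B_n(f, x, ε) = {y | d (f^i y) (f^i x) < ε for 0 ≤ i < n}`. -/
def dynBall (d : X → X → ℝ≥0∞) (f : X → X) (n : ℕ) (x : X) (ε : ℝ) : Set X :=
  {y | ∀ i < n, d (f^[i] y) (f^[i] x) < ENNReal.ofReal ε}

/-- `K ⊆ X` is `(n, δ)`-spanning `S`: every `x ∈ S` is `δ`-shadowed up to time `n - 1` by some
`y ∈ K`. -/
def IsSpanning (d : X → X → ℝ≥0∞) (f : X → X) (n : ℕ) (δ : ℝ) (S K : Set X) : Prop :=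
  ∀ x ∈ S, ∃ y ∈ K, ∀ i < n, d (f^[i] x) (f^[i] y) < ENNReal.ofReal δ

/-- `r_n(f, S, δ)`: the smallest cardinality of an `(n, δ)`-spanning set of `S`
(`⊤` if no finite set is spanning). -/
noncomputable def spanNumber (d : X → X → ℝ≥0∞) (f : X → X) (n : ℕ) (S : Set X) (δ : ℝ) : ℕ∞ :=
  ⨅ (K : Set X) (_ : IsSpanning d f n δ S K), K.encard

/-- The `ε`-tail entropy
`h^*(f, ε) = lim_{δ → 0} limsup_n (1 / n) log sup_x r_n(f, B_n(f, x, ε), δ)`.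
The inner `limsup` does not decrease when `δ > 0` decreases, so the limit is a supremum. -/
noncomputable def tailEntropy (d : X → X → ℝ≥0∞) (f : X → X) (ε : ℝ) : EReal :=
  ⨆ (δ : ℝ) (_ : 0 < δ), Filter.limsup
    (fun n : ℕ ↦ ENNReal.log (⨆ x : X, (spanNumber d f n (dynBall d f n x ε) δ : ℝ≥0∞)) / (n : EReal))
    Filter.atTop

/-- `f` is entropy expansive (`h`-expansive): `h^*(f, ε) = 0` for some `ε > 0`. -/
def IsHExpansive (d : X → X → ℝ≥0∞) (f : X → X) : Prop :=
  ∃ ε : ℝ, 0 < ε ∧ tailEntropy d f ε = 0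

end Entropy

/-! ### Riemannian metrics and endomorphisms on `G ⧸ Λ` -/

section Homogeneous

variable {E : Type*} [NormedAddCommGroup E] [NormedSpace ℝ E]
  {G : Type*} [TopologicalSpace G] [ChartedSpace E G] [Group G]

/-- The Riemannian metric of `G` is invariant under right translation by the elements of `Λ`,
i.e. it is the pullback of a Riemannian metric on the quotient manifold `G ⧸ Λ` under the
projection `G → G ⧸ Λ`. -/
def IsRightInvariantMetric [Bundle.RiemannianBundle (fun x : G ↦ TangentSpace 𝓘(ℝ, E) x)]
    (Λ : Subgroup G) : Prop :=
  ∀ l ∈ Λ, ∀ (x : G) (v : TangentSpace 𝓘(ℝ, E) x),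
    ‖mfderiv 𝓘(ℝ, E) 𝓘(ℝ, E) (fun y : G ↦ y * l) x v‖ = ‖v‖

variable (E) in
/-- The Riemannian distance on `G ⧸ Λ` of the metric induced by a right `Λ`-invariant Riemannian
metric on `G`. Since `C^1` paths in `G ⧸ Λ` lift to `C^1` paths of the same length in `G`, it is the
infimum of the Riemannian distances in `G` between representatives. As usual for a Riemannian
distance, it is `⊤` between points of different connected components. -/
noncomputable def quotientRiemannianEDist
    [Bundle.RiemannianBundle (fun x : G ↦ TangentSpace 𝓘(ℝ, E) x)]
    (Λ : Subgroup G) (p q : G ⧸ Λ) : ℝ≥0∞ :=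
  ⨅ (x : G) (_ : (x : G ⧸ Λ) = p) (y : G) (_ : (y : G ⧸ Λ) = q),
    Manifold.riemannianEDist 𝓘(ℝ, E) x y

variable (E) in
/-- `φ` is an endomorphism of `G ⧸ Λ`: it is the map `g Λ ↦ a Φ(g) Λ` induced by an element `a` of
`G` and a morphism of Lie groups `Φ : G → G` with `Φ(Λ) ⊆ Λ`. -/
def IsHomogeneousEndomorphism (Λ : Subgroup G) (φ : G ⧸ Λ → G ⧸ Λ) : Prop :=
  ∃ (a : G) (Φ : G →* G), ContMDiff 𝓘(ℝ, E) 𝓘(ℝ, E) ∞ Φ ∧ (∀ l ∈ Λ, Φ l ∈ Λ) ∧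
    ∀ g : G, φ (g : G ⧸ Λ) = ((a * Φ g : G) : G ⧸ Λ)

end Homogeneous

/-! With `F g = a * Φ g * a⁻¹` one has `φ (h • p) = F h • φ p`. Since `Λ` is discrete and cocompact,
two points whose `φ`-orbits stay close up to time `n` are `x` and `h • x`, where the `F`-orbit of
`h` stays near `1` (`exists_nhds_orbit`). The theorem thus reduces to a statement about `F`: the set
of such `h` is covered by finitely many small dynamical translates, their number independent of `n`
(`IsLocalScale.exists_finset_cover`). Spanning numbers are then bounded in `n`, and the tail entropy
vanishes.

The covering bound is a volume estimate that needs no information on the expansion of `F`. Near `1`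
square roots exist, are unique and are closer to `1` by a factor `2 / 3`; by uniqueness `F` commutes
with them. Hence each orbit set lies in the squares of the orbit set of `2 / 3` the radius
(`IsLocalScale.orbitSet_subset_image_sq`). Squaring is Lipschitz in a chart, so shrinking the radius
by a fixed factor costs a bounded factor of volume, uniformly in `n`. A maximal packing by
translates then has bounded size. -/

/-! ### Square roots and Lipschitz multiplication in a chart at the identity. -/

section LocalGroup

open Filter Topology Metric Set MeasureTheory

variable {E : Type*} [NormedAddCommGroup E]

/-- The preimage in `G` of the ball of radius `ρ` in a chart, centered at the image of `1`. -/
def chartBall {G : Type*} [TopologicalSpace G] [One G] (ψ : OpenPartialHomeomorph G E) (ρ : ℝ) :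
    Set G :=
  ψ.source ∩ ψ ⁻¹' ball (ψ 1) ρ

section ChartBall

variable {G : Type*} [TopologicalSpace G] [One G] {ψ : OpenPartialHomeomorph G E}

theorem isOpen_chartBall (ρ : ℝ) : IsOpen (chartBall ψ ρ) :=
  ψ.isOpen_inter_preimage isOpen_ball

theorem one_mem_chartBall (h1 : (1 : G) ∈ ψ.source) {ρ : ℝ} (hρ : 0 < ρ) : 1 ∈ chartBall ψ ρ :=
  ⟨h1, mem_ball_self hρ⟩

theorem chartBall_mem_nhds (h1 : (1 : G) ∈ ψ.source) {ρ : ℝ} (hρ : 0 < ρ) :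
    chartBall ψ ρ ∈ 𝓝 (1 : G) :=
  (isOpen_chartBall ρ).mem_nhds (one_mem_chartBall h1 hρ)

theorem chartBall_mono {ρ ρ' : ℝ} (h : ρ ≤ ρ') : chartBall ψ ρ ⊆ chartBall ψ ρ' :=
  fun _ hg ↦ ⟨hg.1, ball_subset_ball h hg.2⟩

theorem exists_chartBall_subset (h1 : (1 : G) ∈ ψ.source) {V : Set G} (hV : V ∈ 𝓝 (1 : G)) :
    ∃ ρ > 0, chartBall ψ ρ ⊆ V := by
  have h2 : ψ.symm ⁻¹' V ∈ 𝓝 (ψ 1) := by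
    apply (ψ.continuousAt_symm (ψ.map_source h1)).preimage_mem_nhds
    rwa [ψ.left_inv h1]
  obtain ⟨ρ, hρ, h⟩ := Metric.mem_nhds_iff.1 h2
  refine ⟨ρ, hρ, fun g hg ↦ ?_⟩
  have := h hg.2
  rwa [mem_preimage, ψ.left_inv hg.1] at this

end ChartBall

variable {G : Type*} [TopologicalSpace G] [Group G]

/-- The multiplication of `G` in a chart is Lipschitz, and the square behaves like `x ↦ 2 x`, on
the ball of radius `r` of the chart. -/
structure IsLocalScale (ψ : OpenPartialHomeomorph G E) (r : ℝ) (L : NNReal) : Prop where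
  pos : 0 < r
  one_mem : (1 : G) ∈ ψ.source
  dist_mul_right : ∀ k ∈ chartBall ψ r, ∀ g ∈ chartBall ψ r, ∀ g' ∈ chartBall ψ r,
    dist (ψ (g * k)) (ψ (g' * k)) ≤ L * dist (ψ g) (ψ g')
  dist_sq : ∀ g ∈ chartBall ψ r, ∀ g' ∈ chartBall ψ r,
    dist (ψ (g * g)) (ψ (g' * g')) ≤ L * dist (ψ g) (ψ g')
  sq_injOn : ∀ g ∈ chartBall ψ r, ∀ g' ∈ chartBall ψ r, g * g = g' * g' → g = g'
  exists_sq : ∀ ρ ≤ r, ∀ h ∈ chartBall ψ ρ, ∃ g ∈ chartBall ψ (2 / 3 * ρ), g * g = h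

variable [NormedSpace ℝ E]

/-- Each partial derivative of a multiplication at its unit is the identity, and the derivative
along the diagonal is their sum. -/
theorem HasStrictFDerivAt.diag_eq_two_smul {m : E × E → E} {M : E × E →L[ℝ] E} {c : E}
    (hM : HasStrictFDerivAt m M (c, c)) (hl : ∀ᶠ x in 𝓝 c, m (x, c) = x)
    (hr : ∀ᶠ x in 𝓝 c, m (c, x) = x) :
    HasStrictFDerivAt (fun x ↦ m (x, x)) ((2 : ℝ) • ContinuousLinearMap.id ℝ E) c := by
  have h1 : HasFDerivAt (fun x ↦ m (x, c))
      (M.comp ((ContinuousLinearMap.id ℝ E).prod 0)) c :=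
    HasFDerivAt.comp (f := fun x : E ↦ (x, c)) c hM.hasFDerivAt
      ((hasFDerivAt_id c).prodMk (hasFDerivAt_const c c))
  have h2 : HasFDerivAt (fun x ↦ m (c, x))
      (M.comp ((0 : E →L[ℝ] E).prod (ContinuousLinearMap.id ℝ E))) c :=
    HasFDerivAt.comp (f := fun x : E ↦ (c, x)) c hM.hasFDerivAt
      ((hasFDerivAt_const c c).prodMk (hasFDerivAt_id c))
  have e1 := h1.unique ((hasFDerivAt_id c).congr_of_eventuallyEq hl)
  have e2 := h2.unique ((hasFDerivAt_id c).congr_of_eventuallyEq hr)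
  have h3 : HasStrictFDerivAt (fun x ↦ m (x, x))
      (M.comp ((ContinuousLinearMap.id ℝ E).prod (ContinuousLinearMap.id ℝ E))) c :=
    HasStrictFDerivAt.comp (f := fun x : E ↦ (x, x)) c hM
      ((hasStrictFDerivAt_id c).prodMk (hasStrictFDerivAt_id c))
  convert h3 using 1
  ext v
  have e1 := DFunLike.congr_fun e1 v
  have e2 := DFunLike.congr_fun e2 v
  simp only [ContinuousLinearMap.comp_apply, ContinuousLinearMap.prod_apply,
    ContinuousLinearMap.id_apply, zero_apply] at e1 e2 ⊢
  rw [show (v, v) = (v, 0) + ((0, v) : E × E) by simp, map_add, e1, e2]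
  simp [two_smul]

theorem exists_isLocalScale [CompleteSpace E] [ContinuousMul G] (ψ : OpenPartialHomeomorph G E)
    (h1 : (1 : G) ∈ ψ.source)
    (hm : ContDiffAt ℝ 1 (fun p : E × E ↦ ψ (ψ.symm p.1 * ψ.symm p.2)) (ψ 1, ψ 1)) :
    ∃ r L, IsLocalScale ψ r L := by
  set c := ψ 1
  set m := fun p : E × E ↦ ψ (ψ.symm p.1 * ψ.symm p.2)
  have hs : ψ.symm c = 1 := ψ.left_inv h1
  have htgt : ∀ᶠ x in 𝓝 c, x ∈ ψ.target := ψ.open_target.mem_nhds (ψ.map_source h1)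
  have hM := hm.hasStrictFDerivAt one_ne_zero
  have hsq := hM.diag_eq_two_smul
    (htgt.mono fun x hx ↦ by simp [m, hs, ψ.right_inv hx])
    (htgt.mono fun x hx ↦ by simp [m, hs, ψ.right_inv hx])
  obtain ⟨K, s, hsn, hK⟩ := hM.exists_lipschitzOnWith
  -- With error `1 / 2` around `2 • id`, squaring expands distances by at least `3 / 2`: this gives
  -- uniqueness of square roots and the contraction factor `2 / 3`.
  obtain ⟨t, ht, hap⟩ := hsq.approximates_deriv_on_nhds (c := 1 / 2) (Or.inr (by norm_num))
  have hmul : ∀ᶠ g in 𝓝 (1 : G), g * g ∈ ψ.source :=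
    ((continuous_id.mul continuous_id).continuousAt (x := (1 : G))).preimage_mem_nhds
      (by simpa using ψ.open_source.mem_nhds h1)
  obtain ⟨r₁, hr₁, hr₁'⟩ := exists_chartBall_subset h1 hmul
  obtain ⟨r₂, hr₂, hr₂'⟩ := Metric.mem_nhds_iff.1 (htgt.and ht)
  obtain ⟨r₃, hr₃, hr₃'⟩ := Metric.mem_nhds_iff.1 hsn
  obtain ⟨r, hr, hra, hrb, hrc⟩ : ∃ r > 0, r ≤ r₁ ∧ r ≤ r₂ ∧ r ≤ r₃ :=
    ⟨min r₁ (min r₂ r₃), by positivity, by simp, by simp, by simp⟩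
  have hmem : ∀ {g k}, g ∈ chartBall ψ r → k ∈ chartBall ψ r → (ψ g, ψ k) ∈ s := by
    intro g k hg hk
    apply hr₃'
    rw [← ball_prod_same]
    exact ⟨ball_subset_ball hrc hg.2, ball_subset_ball hrc hk.2⟩
  have hmψ : ∀ {g k}, g ∈ chartBall ψ r → k ∈ chartBall ψ r → m (ψ g, ψ k) = ψ (g * k) := by
    intro g k hg hk
    simp only [m, ψ.left_inv hg.1, ψ.left_inv hk.1]
  have hsource : ∀ {g}, g ∈ chartBall ψ r → g * g ∈ ψ.source :=
    fun hg ↦ hr₁' (chartBall_mono hra hg)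
  refine ⟨r, K, hr, h1, ?_, ?_, ?_, ?_⟩
  · intro k hk g hg g' hg'
    have := hK.dist_le_mul _ (hmem hg hk) _ (hmem hg' hk)
    rwa [hmψ hg hk, hmψ hg' hk, Prod.dist_eq, dist_self, max_eq_left dist_nonneg] at this
  · intro g hg g' hg'
    have := hK.dist_le_mul _ (hmem hg hg) _ (hmem hg' hg')
    rwa [hmψ hg hg, hmψ hg' hg', Prod.dist_eq, max_self] at this
  · intro g hg g' hg' h
    have := hap (ψ g) (hr₂' (ball_subset_ball hrb hg.2)).2
      (ψ g') (hr₂' (ball_subset_ball hrb hg'.2)).2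
    simp only [hmψ hg hg, hmψ hg' hg', h, sub_self, zero_sub, norm_neg] at this
    rw [smul_apply, ContinuousLinearMap.id_apply, norm_smul] at this
    have h0 := norm_nonneg (ψ g - ψ g')
    norm_num at this
    have : ‖ψ g - ψ g'‖ = 0 := by linarith
    exact ψ.injOn hg.1 hg'.1 (sub_eq_zero.1 (norm_eq_zero.1 this))
  · intro ρ hρ h hh
    -- Halving inverts `2 • id` with norm `1 / 2`, so the closed ball of radius `2 / 3 * dist (ψ h)
    -- c` is mapped over one of radius `(2 - 1 / 2) * (2 / 3) * dist (ψ h) c = dist (ψ h) c`.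
    let N : ContinuousLinearMap.NonlinearRightInverse ((2 : ℝ) • ContinuousLinearMap.id ℝ E) :=
      { toFun := fun y ↦ (1 / 2 : ℝ) • y
        nnnorm := 1 / 2
        bound' := fun y ↦ by rw [norm_smul]; norm_num
        right_inv' := fun y ↦ by simp }
    have hd : dist (ψ h) c < ρ := hh.2
    have hd0 : 0 ≤ dist (ψ h) c := dist_nonneg
    have hsub : closedBall c (2 / 3 * dist (ψ h) c) ⊆ ball c r :=
      closedBall_subset_ball (by linarith)
    have := hap.surjOn_closedBall_of_nonlinearRightInverse N (b := c)
      (ε := 2 / 3 * dist (ψ h) c) (by positivity)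
      (fun x hx ↦ (hr₂' (ball_subset_ball hrb (hsub hx))).2)
    have hcc : m (c, c) = c := by simp [m, hs, c]
    obtain ⟨x, hx, hxh⟩ := this (a := ψ h) (by
      rw [hcc, mem_closedBall]
      have : (((N.nnnorm : ℝ)⁻¹ - ((1 / 2 : NNReal) : ℝ)) * (2 / 3 * dist (ψ h) c))
        = dist (ψ h) c := by
        simp [N]; ring
      rw [this])
    have hxt : x ∈ ψ.target := (hr₂' (ball_subset_ball hrb (hsub hx))).1
    have hxr : ψ.symm x ∈ chartBall ψ r :=
      ⟨ψ.map_target hxt, by rw [mem_preimage, ψ.right_inv hxt]; exact hsub hx⟩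
    refine ⟨ψ.symm x, ⟨ψ.map_target hxt, ?_⟩, ψ.injOn (hsource hxr) hh.1 hxh⟩
    rw [mem_preimage, ψ.right_inv hxt]
    exact closedBall_subset_ball (by linarith) hx

end LocalGroup

/-! ### Volume and bounded covering of orbit sets. -/

section OrbitSets

open Filter Topology Metric Set MeasureTheory Module
open scoped NNReal

variable {E : Type*} [NormedAddCommGroup E] {G : Type*} [TopologicalSpace G] [Group G]

/-- The elements whose orbit under `F` stays in the chart ball of radius `ρ` up to time `n`. -/
def orbitSet (ψ : OpenPartialHomeomorph G E) (F : G →* G) (n : ℕ) (ρ : ℝ) : Set G :=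
  {h | ∀ i ≤ n, F^[i] h ∈ chartBall ψ ρ}

variable {ψ : OpenPartialHomeomorph G E} {F : G →* G}

theorem orbitSet_subset (n : ℕ) (ρ : ℝ) : orbitSet ψ F n ρ ⊆ chartBall ψ ρ :=
  fun _ hh ↦ hh 0 n.zero_le

theorem orbitSet_mono (n : ℕ) {ρ ρ' : ℝ} (h : ρ ≤ ρ') : orbitSet ψ F n ρ ⊆ orbitSet ψ F n ρ' :=
  fun _ hh i hi ↦ chartBall_mono h (hh i hi)

theorem isOpen_orbitSet (hF : Continuous F) (n : ℕ) (ρ : ℝ) : IsOpen (orbitSet ψ F n ρ) := by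
  have : orbitSet ψ F n ρ = ⋂ i ∈ Set.Iic n, F^[i] ⁻¹' chartBall ψ ρ := by
    ext h; simp [orbitSet]
  rw [this]
  exact (Set.finite_Iic n).isOpen_biInter
    fun i _ ↦ (isOpen_chartBall ρ).preimage (hF.iterate i)

theorem one_mem_orbitSet (h1 : (1 : G) ∈ ψ.source) (n : ℕ) {ρ : ℝ} (hρ : 0 < ρ) :
    1 ∈ orbitSet ψ F n ρ := fun i _ ↦ by
  rw [iterate_map_one]
  exact one_mem_chartBall h1 hρ

variable {r : ℝ} {L : ℝ≥0}

theorem IsLocalScale.orbitSet_subset_image_sq (hψ : IsLocalScale ψ r L) {ρ₀ : ℝ} (hρ₀ : ρ₀ ≤ r)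
    (hF : ∀ g ∈ chartBall ψ ρ₀, F g ∈ chartBall ψ r) {ρ : ℝ} (hρ0 : 0 ≤ ρ) (hρ : ρ ≤ ρ₀) (n : ℕ) :
    orbitSet ψ F n ρ ⊆ (fun g ↦ g * g) '' orbitSet ψ F n (2 / 3 * ρ) := by
  intro h hh
  choose! s hs hsq using fun g hg ↦ hψ.exists_sq ρ (hρ.trans hρ₀) g hg
  -- `F (s (F^[i] h))` and `s (F^[i + 1] h)` are square roots of the same element inside the ball of
  -- radius `r`, hence equal.
  have key : ∀ i ≤ n, F^[i] (s h) = s (F^[i] h) := by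
    intro i
    induction i with
    | zero => intro _; rfl
    | succ i ih =>
      intro hi
      have hi' : i ≤ n := by omega
      rw [Function.iterate_succ_apply', ih hi']
      refine hψ.sq_injOn _ (hF _ (chartBall_mono (by linarith) (hs _ (hh i hi'))))
        _ (chartBall_mono (by linarith) (hs _ (hh _ hi))) ?_
      rw [hsq _ (hh _ hi), ← map_mul, hsq _ (hh i hi'), Function.iterate_succ_apply']
  refine ⟨s h, fun i hi ↦ ?_, hsq _ (hh 0 n.zero_le)⟩
  rw [key i hi]
  exact hs _ (hh i hi)

variable [NormedSpace ℝ E] [MeasurableSpace E] [BorelSpace E]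

omit [TopologicalSpace G] in
variable (E) in
theorem hausdorffMeasure_image_le_of_dist_le {ψ : G → E} {f : G → G} {s : Set G}
    (hinj : InjOn ψ s) (hf : ∀ g ∈ s, ∀ g' ∈ s, dist (ψ (f g)) (ψ (f g')) ≤ L * dist (ψ g) (ψ g')) :
    μH[finrank ℝ E] (ψ '' (f '' s)) ≤ (L ^ finrank ℝ E : ℝ≥0) * μH[finrank ℝ E] (ψ '' s) := by
  have hl : LipschitzOnWith L (fun x ↦ ψ (f (Function.invFunOn ψ s x))) (ψ '' s) := by
    apply LipschitzOnWith.of_dist_le_mul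
    rintro _ ⟨g, hg, rfl⟩ _ ⟨g', hg', rfl⟩
    simp only [hinj.leftInvOn_invFunOn hg, hinj.leftInvOn_invFunOn hg']
    exact hf g hg g' hg'
  have := hl.hausdorffMeasure_image_le (d := finrank ℝ E) (by positivity)
  rw [image_image] at this ⊢
  rw [image_congr fun g hg ↦ by rw [hinj.leftInvOn_invFunOn hg]] at this
  simpa using this

/-- Each extraction of square roots costs a factor `L ^ finrank ℝ E`, whatever `n` is. -/
theorem IsLocalScale.hausdorffMeasure_orbitSet_le (hψ : IsLocalScale ψ r L) {ρ₀ : ℝ}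
    (hρ₀0 : 0 < ρ₀) (hρ₀ : ρ₀ ≤ r) (hF : ∀ g ∈ chartBall ψ ρ₀, F g ∈ chartBall ψ r) (n m : ℕ) :
    μH[finrank ℝ E] (ψ '' orbitSet ψ F n ρ₀) ≤ ((L ^ finrank ℝ E) ^ m : ℝ≥0) *
      μH[finrank ℝ E] (ψ '' orbitSet ψ F n ((2 / 3) ^ m * ρ₀)) := by
  induction m with
  | zero => simp
  | succ m ih =>
    refine ih.trans ?_
    have hle : (2 / 3 : ℝ) ^ m * ρ₀ ≤ ρ₀ :=
      mul_le_of_le_one_left hρ₀0.le (pow_le_one₀ (by norm_num) (by norm_num))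
    have h1 := hψ.orbitSet_subset_image_sq hρ₀ hF (ρ := (2 / 3) ^ m * ρ₀) (by positivity) hle n
    rw [← mul_assoc, ← pow_succ'] at h1
    have hsub : orbitSet ψ F n ((2 / 3) ^ (m + 1) * ρ₀) ⊆ chartBall ψ r := by
      refine (orbitSet_subset _ _).trans (chartBall_mono (le_trans ?_ hρ₀))
      exact mul_le_of_le_one_left hρ₀0.le (pow_le_one₀ (by norm_num) (by norm_num))
    have h2 := hausdorffMeasure_image_le_of_dist_le E (ψ := ψ) (f := fun g ↦ g * g)
      (ψ.injOn.mono fun g hg ↦ (hsub hg).1)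
      (fun g hg g' hg' ↦ hψ.dist_sq g (hsub hg) g' (hsub hg'))
    rw [pow_succ, ENNReal.coe_mul, mul_assoc]
    gcongr
    exact (measure_mono (image_mono h1)).trans h2

theorem exists_finset_maximal_card {α : Type*} {P : Finset α → Prop} (h0 : P ∅) {N : ℕ}
    (hN : ∀ K, P K → K.card ≤ N) : ∃ K, P K ∧ ∀ K', P K' → K'.card ≤ K.card := by
  have hb : BddAbove {k | ∃ K, P K ∧ K.card = k} := ⟨N, by rintro _ ⟨K, hK, rfl⟩; exact hN K hK⟩
  obtain ⟨K, hK, hKc⟩ := Nat.sSup_mem (s := {k | ∃ K, P K ∧ K.card = k}) ⟨0, ∅, h0, rfl⟩ hb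
  exact ⟨K, hK, fun K' hK' ↦ hKc ▸ le_csSup hb ⟨K', hK', rfl⟩⟩

variable [FiniteDimensional ℝ E] [IsTopologicalGroup G]

/-- The number of disjoint right translates of a small orbit set with centers in a fixed orbit set
is bounded uniformly in time. -/
theorem IsLocalScale.card_le_of_pairwiseDisjoint (hψ : IsLocalScale ψ r L) (hFc : Continuous F)
    {ρ₀ ρ₁ ρ₂ : ℝ} (hρ₀0 : 0 < ρ₀) (hρ₂0 : 0 < ρ₂) (hρ₀ : ρ₀ ≤ r)
    (hF : ∀ g ∈ chartBall ψ ρ₀, F g ∈ chartBall ψ r)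
    (hinv : ∀ g ∈ chartBall ψ ρ₁, g⁻¹ ∈ chartBall ψ r)
    (hmul : ∀ g ∈ chartBall ψ ρ₂, ∀ k ∈ chartBall ψ ρ₁, g * k ∈ chartBall ψ ρ₀)
    {m : ℕ} (hm : (2 / 3) ^ m * ρ₀ ≤ ρ₂) {n : ℕ} {K : Finset G}
    (hK : (K : Set G) ⊆ orbitSet ψ F n ρ₁)
    (hd : (K : Set G).PairwiseDisjoint fun k ↦ (· * k) '' orbitSet ψ F n ρ₂) :
    (K.card : ℝ≥0) ≤ (L ^ finrank ℝ E) ^ (m + 1) := by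
  set C := L ^ finrank ℝ E
  set S := orbitSet ψ F n ρ₂
  have hS0 : μH[finrank ℝ E] (ψ '' S) ≠ 0 := by
    refine (IsOpen.measure_pos _ ?_ ⟨_, mem_image_of_mem ψ (one_mem_orbitSet hψ.one_mem n hρ₂0)⟩).ne'
    exact ψ.isOpen_image_of_subset_source (isOpen_orbitSet hFc n ρ₂)
      fun g hg ↦ (orbitSet_subset n ρ₂ hg).1
  have hSt : μH[finrank ℝ E] (ψ '' S) ≠ ⊤ := by
    refine measure_ne_top_of_subset ?_
      (measure_ball_lt_top (μ := (μH[finrank ℝ E] : Measure E)) (x := ψ 1) (r := ρ₂)).ne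
    rintro _ ⟨g, hg, rfl⟩
    exact (orbitSet_subset n ρ₂ hg).2
  have htrans : ∀ k ∈ K, (· * k) '' S ⊆ orbitSet ψ F n ρ₀ := by
    rintro k hk _ ⟨g, hg, rfl⟩ i hi
    rw [iterate_map_mul]
    exact hmul _ (hg i hi) _ (hK hk i hi)
  -- Translating back by `k⁻¹` is `L`-Lipschitz in the chart, so no translate has less than `1 / C`
  -- of the volume.
  have hlow : ∀ k ∈ K, μH[finrank ℝ E] (ψ '' S) ≤ C * μH[finrank ℝ E] (ψ '' ((· * k) '' S)) := by
    intro k hk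
    have hsub : (· * k) '' S ⊆ chartBall ψ r :=
      ((htrans k hk).trans (orbitSet_subset _ _)).trans (chartBall_mono hρ₀)
    have := hausdorffMeasure_image_le_of_dist_le E (ψ := ψ) (f := (· * k⁻¹)) (s := (· * k) '' S)
      (ψ.injOn.mono fun g hg ↦ (hsub hg).1)
      (fun g hg g' hg' ↦ hψ.dist_mul_right _ (hinv _ (orbitSet_subset _ _ (hK hk)))
        g (hsub hg) g' (hsub hg'))
    simpa only [image_image, mul_inv_cancel_right, image_id'] using this
  have hsum : ∑ k ∈ K, μH[finrank ℝ E] (ψ '' ((· * k) '' S))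
      ≤ μH[finrank ℝ E] (ψ '' orbitSet ψ F n ρ₀) := by
    rw [← measure_biUnion_finset]
    · refine measure_mono (iUnion₂_subset fun k hk ↦ image_mono (htrans k hk))
    · intro k hk k' hk' hne
      refine disjoint_image_image fun g hg g' hg' heq ↦ ?_
      have := ψ.injOn (orbitSet_subset _ _ (htrans k hk hg)).1
        (orbitSet_subset _ _ (htrans k' hk' hg')).1 heq
      exact disjoint_left.1 (hd hk hk' hne) hg (this ▸ hg')
    · intro k hk
      refine (ψ.isOpen_image_of_subset_source ?_ ?_).measurableSet
      · exact isOpenMap_mul_right k _ (isOpen_orbitSet hFc n ρ₂)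
      · exact fun g hg ↦ (orbitSet_subset n ρ₀ (htrans k hk hg)).1
  -- One factor `C` pays for the translation and `C ^ m` for the shrinking from `ρ₀` to `ρ₂`.
  have hfinal : (K.card : ℝ≥0∞) * μH[finrank ℝ E] (ψ '' S)
      ≤ (C ^ (m + 1) : ℝ≥0) * μH[finrank ℝ E] (ψ '' S) := by
    calc (K.card : ℝ≥0∞) * μH[finrank ℝ E] (ψ '' S)
        = ∑ k ∈ K, μH[finrank ℝ E] (ψ '' S) := by simp
      _ ≤ ∑ k ∈ K, C * μH[finrank ℝ E] (ψ '' ((· * k) '' S)) := Finset.sum_le_sum hlow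
      _ ≤ C * μH[finrank ℝ E] (ψ '' orbitSet ψ F n ρ₀) := by rw [← Finset.mul_sum]; gcongr
      _ ≤ C * ((C ^ m : ℝ≥0) * μH[finrank ℝ E] (ψ '' orbitSet ψ F n ((2 / 3) ^ m * ρ₀))) := by
        gcongr; exact hψ.hausdorffMeasure_orbitSet_le hρ₀0 hρ₀ hF n m
      _ ≤ C * ((C ^ m : ℝ≥0) * μH[finrank ℝ E] (ψ '' S)) := by
        gcongr; exact orbitSet_mono n hm
      _ = _ := by rw [pow_succ', ENNReal.coe_mul, mul_assoc]
  rw [ENNReal.mul_le_mul_iff_left hS0 hSt] at hfinal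
  exact_mod_cast hfinal

omit [MeasurableSpace E] [BorelSpace E] in
/-- Bounded covering of orbit sets: for a continuous endomorphism of a locally Euclidean group,
the set of points staying near `1` up to time `n` is covered, in the sense of the `n`-step dynamics,
by a number of small translates that does not depend on `n`. -/
theorem IsLocalScale.exists_finset_cover (hψ : IsLocalScale ψ r L) (hFc : Continuous F) :
    ∃ U ∈ 𝓝 (1 : G), ∀ V ∈ 𝓝 (1 : G), ∃ N : ℕ, ∀ n : ℕ, ∃ K : Finset G, K.card ≤ N ∧
      ∀ h, (∀ i ≤ n, F^[i] h ∈ U) → ∃ k ∈ K, ∀ i ≤ n, F^[i] (h * k⁻¹) ∈ V := by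
  classical
  borelize E
  have h1 := hψ.one_mem
  obtain ⟨ρ₀, hρ₀0, hρ₀⟩ := exists_chartBall_subset h1 (inter_mem
    (chartBall_mem_nhds h1 hψ.pos)
    (hFc.continuousAt.preimage_mem_nhds (by rw [map_one]; exact chartBall_mem_nhds h1 hψ.pos)))
  wlog hρ₀r : ρ₀ ≤ r generalizing ρ₀
  · exact this r hψ.pos ((chartBall_mono (le_of_not_ge hρ₀r)).trans hρ₀) le_rfl
  have hmul1 : ∀ᶠ p : G × G in 𝓝 1 ×ˢ 𝓝 1, p.1 * p.2 ∈ chartBall ψ ρ₀ := by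
    rw [← nhds_prod_eq]
    exact (continuous_mul.continuousAt (x := ((1, 1) : G × G))).preimage_mem_nhds
      (by simpa using chartBall_mem_nhds h1 hρ₀0)
  obtain ⟨W, hW, hWmul⟩ := eventually_prod_self_iff
    (r := fun g k ↦ g * k ∈ chartBall ψ ρ₀).1 hmul1
  have hinv1 : ∀ᶠ g : G in 𝓝 1, g⁻¹ ∈ chartBall ψ r :=
    continuous_inv.continuousAt.preimage_mem_nhds (by simpa using chartBall_mem_nhds h1 hψ.pos)
  obtain ⟨ρ₁, hρ₁0, hρ₁⟩ := exists_chartBall_subset h1 (inter_mem hW hinv1)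
  refine ⟨chartBall ψ ρ₁, chartBall_mem_nhds h1 hρ₁0, fun V hV ↦ ?_⟩
  have hdiv : ∀ᶠ p : G × G in 𝓝 1 ×ˢ 𝓝 1, p.1⁻¹ * p.2 ∈ V := by
    rw [← nhds_prod_eq]
    exact ((continuous_fst.inv.mul continuous_snd).continuousAt
      (x := ((1, 1) : G × G))).preimage_mem_nhds (by simpa using hV)
  obtain ⟨W', hW', hWdiv⟩ := eventually_prod_self_iff
    (r := fun g k ↦ g⁻¹ * k ∈ V).1 hdiv
  obtain ⟨ρ₂, hρ₂0, hρ₂⟩ := exists_chartBall_subset h1 (inter_mem hW hW')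
  obtain ⟨m, hm⟩ := exists_pow_lt_of_lt_one (div_pos hρ₂0 hρ₀0) (by norm_num : (2 / 3 : ℝ) < 1)
  rw [lt_div_iff₀ hρ₀0] at hm
  set N := ⌊(L ^ finrank ℝ E) ^ (m + 1)⌋₊
  refine ⟨N, fun n ↦ ?_⟩
  have hN : ∀ K : Finset G, ((K : Set G) ⊆ orbitSet ψ F n ρ₁ ∧
      (K : Set G).PairwiseDisjoint fun k ↦ (· * k) '' orbitSet ψ F n ρ₂) → K.card ≤ N := by
    rintro K ⟨hK, hd⟩
    refine Nat.le_floor (hψ.card_le_of_pairwiseDisjoint hFc hρ₀0 hρ₂0 hρ₀r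
      (fun g hg ↦ (hρ₀ hg).2) (fun g hg ↦ (hρ₁ hg).2)
      (fun g hg k hk ↦ hWmul _ (hρ₂ hg).1 _ (hρ₁ hk).1) hm.le hK hd)
  obtain ⟨K, ⟨hK, hd⟩, hmax⟩ := exists_finset_maximal_card (by simp) hN
  refine ⟨K, hN K ⟨hK, hd⟩, fun h hh ↦ ?_⟩
  -- Maximality makes the packing a covering: if `a * h = b * k`, then `h * k⁻¹ = a⁻¹ * b`, whose
  -- orbit is a quotient of two orbits near `1`.
  suffices H : ∃ k ∈ K, ¬ Disjoint ((· * h) '' orbitSet ψ F n ρ₂)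
      ((· * k) '' orbitSet ψ F n ρ₂) by
    obtain ⟨k, hk, hnd⟩ := H
    obtain ⟨_, ⟨a, ha, rfl⟩, ⟨b, hb, hab⟩⟩ := not_disjoint_iff.1 hnd
    have hab : b * k = a * h := hab
    refine ⟨k, hk, fun i hi ↦ ?_⟩
    have : h * k⁻¹ = a⁻¹ * b := by
      rw [mul_inv_eq_iff_eq_mul, mul_assoc, hab, inv_mul_cancel_left]
    rw [this, iterate_map_mul, iterate_map_inv]
    exact hWdiv _ (hρ₂ (ha i hi)).2 _ (hρ₂ (hb i hi)).2
  by_contra! H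
  -- If `h ∈ K`, nothing can be inserted, but the translate by `h` meets itself because it contains
  -- `1 * h`.
  by_cases hhK : h ∈ K
  · have := H h hhK
    rw [disjoint_self, bot_eq_empty, image_eq_empty] at this
    exact (this ▸ one_mem_orbitSet h1 n hρ₂0 : (1 : G) ∈ (∅ : Set G))
  · have := hmax (insert h K) ⟨?_, ?_⟩
    · rw [Finset.card_insert_of_notMem hhK] at this
      omega
    · rw [Finset.coe_insert]
      exact insert_subset hh hK
    · rw [Finset.coe_insert]
      exact hd.insert fun k hk _ ↦ H k hk

end OrbitSets

/-! ### From bounded spanning numbers to zero tail entropy. -/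

section TailEntropy

open Filter Topology

variable {X : Type*} {d : X → X → ℝ≥0∞} {f : X → X}

theorem spanNumber_le_card {n N : ℕ} {δ : ℝ} {S : Set X} (K : Finset X) (hK : K.card ≤ N)
    (h : IsSpanning d f n δ S K) : spanNumber d f n S δ ≤ N :=
  (iInf₂_le (K : Set X) h).trans (by rw [Set.encard_coe_eq_coe_finsetCard]; exact_mod_cast hK)

theorem one_le_spanNumber {n : ℕ} {δ : ℝ} {S : Set X} (hS : S.Nonempty) :
    1 ≤ spanNumber d f n S δ := by
  refine le_iInf₂ fun K hK ↦ ?_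
  obtain ⟨x, hx⟩ := hS
  obtain ⟨y, hy, -⟩ := hK x hx
  exact Set.one_le_encard_iff_nonempty.2 ⟨y, hy⟩

/-- If the spanning numbers of the dynamical balls of radius `ε` are bounded uniformly in time,
then the tail entropy at scale `ε` vanishes. -/
theorem tailEntropy_eq_zero_of_spanNumber_le [Nonempty X] (hd : ∀ x, d x x = 0) {ε : ℝ}
    (hε : 0 < ε) (h : ∀ δ > 0, ∃ N : ℕ, ∀ᶠ n in atTop, ∀ x,
      spanNumber d f n (dynBall d f n x ε) δ ≤ N) :
    tailEntropy d f ε = 0 := by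
  have key : ∀ δ : ℝ, 0 < δ → limsup (fun n : ℕ ↦
      ENNReal.log (⨆ x : X, (spanNumber d f n (dynBall d f n x ε) δ : ℝ≥0∞)) / (n : EReal))
      atTop = 0 := by
    intro δ hδ
    obtain ⟨N, hN⟩ := h δ hδ
    apply Tendsto.limsup_eq
    have hz : Tendsto (fun n : ℕ ↦ ((Real.log (N + 1) : ℝ) : EReal) / (n : EReal)) atTop (𝓝 0) := by
      have := (continuous_coe_real_ereal.tendsto _).comp
        (tendsto_const_div_atTop_nhds_zero_nat (Real.log (N + 1)))
      simpa [Function.comp_def, EReal.coe_div] using this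
    refine tendsto_of_tendsto_of_tendsto_of_le_of_le' tendsto_const_nhds hz ?_ ?_
    · filter_upwards with n
      refine EReal.div_nonneg ?_ (by positivity)
      rw [ENNReal.zero_le_log_iff]
      obtain ⟨x⟩ := ‹Nonempty X›
      refine le_iSup_of_le x ?_
      have : 1 ≤ spanNumber d f n (dynBall d f n x ε) δ :=
        one_le_spanNumber ⟨x, fun i _ ↦ by rw [hd]; simpa using hε⟩
      exact_mod_cast this
    · filter_upwards [hN] with n hn
      refine EReal.div_le_div_right_of_nonneg (by positivity) ?_
      have : (⨆ x : X, (spanNumber d f n (dynBall d f n x ε) δ : ℝ≥0∞)) ≤ ENNReal.ofReal (N + 1) := by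
        refine iSup_le fun x ↦ ?_
        have h1 : (spanNumber d f n (dynBall d f n x ε) δ : ℝ≥0∞) ≤ (N : ℝ≥0∞) := by
          exact_mod_cast hn x
        refine h1.trans ?_
        rw [← ENNReal.ofReal_natCast]
        exact ENNReal.ofReal_le_ofReal (by linarith)
      refine (ENNReal.log_monotone this).trans ?_
      rw [ENNReal.log_ofReal_of_pos (by positivity)]
  rw [tailEntropy]
  apply le_antisymm
  · exact iSup₂_le fun δ hδ ↦ (key δ hδ).le
  · exact le_iSup₂_of_le 1 one_pos (key 1 one_pos).ge

end TailEntropy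

/-! ### Uniformity from compactness of the quotient. -/

section Cocompact

open Filter Topology

/-- A right `Λ`-invariant property that holds locally uniformly holds uniformly, if `G ⧸ Λ` is
compact. -/
theorem eventually_forall_of_compactSpace_quotient {G ι : Type*} [TopologicalSpace G] [Group G]
    [ContinuousMul G] (Λ : Subgroup G) [CompactSpace (G ⧸ Λ)] {l : Filter ι} {P : ι → G → Prop}
    (hP : ∀ u g, ∀ x ∈ Λ, P u (g * x) → P u g) (h : ∀ g, ∀ᶠ p : ι × G in l ×ˢ 𝓝 g, P p.1 p.2) :
    ∀ᶠ u in l, ∀ g, P u g := by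
  choose S hS T hT hST using fun g ↦ eventually_prod_iff.1 (h g)
  obtain ⟨t, -, ht⟩ := isCompact_univ.elim_nhds_subcover (X := G ⧸ Λ)
    (fun p ↦ (QuotientGroup.mk : G → G ⧸ Λ) '' {g | T p.out g}) fun p _ ↦ by
      have := QuotientGroup.isOpenMap_coe (N := Λ) |>.image_mem_nhds (hT p.out)
      rwa [QuotientGroup.out_eq'] at this
  filter_upwards [(Finset.eventually_all t).2 fun p _ ↦ hS p.out] with u hu g
  obtain ⟨p, hp, g', hg', hgg⟩ := Set.mem_iUnion₂.1 (ht (Set.mem_univ (g : G ⧸ Λ)))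
  have := hST p.out (hu p hp) hg'
  refine hP u g (g⁻¹ * g') (QuotientGroup.eq.1 hgg.symm) ?_
  rwa [mul_inv_cancel_left]

/-- The stabilizer of `g Λ` is `g Λ g⁻¹`, which is discrete locally uniformly in `g` and depends
only on the coset. -/
theorem eventually_smul_injective {G : Type*} [TopologicalSpace G] [Group G]
    [IsTopologicalGroup G] (Λ : Subgroup G) [DiscreteTopology Λ] [CompactSpace (G ⧸ Λ)] :
    ∀ᶠ u in 𝓝 (1 : G), ∀ p : G ⧸ Λ, u • p = p → u = 1 := by
  have h := eventually_forall_of_compactSpace_quotient Λ (l := 𝓝 (1 : G))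
    (P := fun u g ↦ g⁻¹ * u * g ∈ Λ → u = 1) ?_ ?_
  · filter_upwards [h] with u hu p hp
    induction p using QuotientGroup.induction_on with
    | H g =>
      apply hu g
      rw [mul_assoc, ← QuotientGroup.eq]
      exact hp.symm
  · intro u g x hx h hu
    refine h ?_
    have := Λ.mul_mem (Λ.mul_mem (Λ.inv_mem hx) hu) hx
    simpa [mul_assoc] using this
  · intro g
    obtain ⟨O, hO, hO1⟩ : ∃ O ∈ 𝓝 (1 : G), ∀ x ∈ O, x ∈ Λ → x = 1 := by
      have h1 : ({1} : Set Λ) ∈ 𝓝 (1 : Λ) := by simp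
      rw [nhds_subtype, mem_comap] at h1
      obtain ⟨O, hO, hsub⟩ := h1
      exact ⟨O, hO, fun x hx hxΛ ↦ congrArg Subtype.val (@hsub ⟨x, hxΛ⟩ hx)⟩
    rw [← nhds_prod_eq]
    have hc : ContinuousAt (fun p : G × G ↦ p.2⁻¹ * p.1 * p.2) (1, g) :=
      ((continuous_snd.inv.mul continuous_fst).mul continuous_snd).continuousAt
    filter_upwards [hc.preimage_mem_nhds (by simpa using hO)] with p hp hpΛ
    have := hO1 _ hp hpΛ
    simpa [mul_eq_one_iff_eq_inv, mul_assoc, inv_mul_eq_one] using this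

end Cocompact

/-! ### Comparison of the quotient distance with the action of small group elements. -/

section Riemannian

theorem IsContMDiffRiemannianBundle.isContinuousRiemannianBundle
    {EB : Type*} [NormedAddCommGroup EB] [NormedSpace ℝ EB]
    {HB : Type*} [TopologicalSpace HB] (IB : ModelWithCorners ℝ EB HB) (n : ℕ∞ω)
    {B : Type*} [TopologicalSpace B] [ChartedSpace HB B]
    (F : Type*) [NormedAddCommGroup F] [NormedSpace ℝ F]
    (E : B → Type*) [TopologicalSpace (Bundle.TotalSpace F E)] [∀ x, NormedAddCommGroup (E x)]
    [∀ x, InnerProductSpace ℝ (E x)] [FiberBundle F E] [VectorBundle ℝ F E]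
    [h : IsContMDiffRiemannianBundle IB n F E] : IsContinuousRiemannianBundle F E := by
  obtain ⟨g, hg, hg'⟩ := h.exists_contMDiff
  exact ⟨g, hg.continuous, hg'⟩

open Filter Topology Manifold

variable {E : Type*} [NormedAddCommGroup E] [NormedSpace ℝ E]
  {G : Type*} [TopologicalSpace G] [ChartedSpace E G] [Group G] [LieGroup 𝓘(ℝ, E) ∞ G]

theorem exists_isLocalScale_chartAt [CompleteSpace E] :
    ∃ r L, IsLocalScale (chartAt E (1 : G)) r L := by
  have : IsTopologicalGroup G := topologicalGroup_of_lieGroup 𝓘(ℝ, E) ∞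
  have : IsManifold 𝓘(ℝ, E) ∞ G := inferInstance
  have : IsManifold 𝓘(ℝ, E) 1 G := inferInstance
  have : ContMDiffMul 𝓘(ℝ, E) 1 G := inferInstance
  set ψ := chartAt E (1 : G)
  have h1 : (1 : G) ∈ ψ.source := mem_chart_source E 1
  refine exists_isLocalScale ψ h1 (contMDiffAt_iff_contDiffAt.1 ?_)
  have hsymm : ContMDiffAt 𝓘(ℝ, E) 𝓘(ℝ, E) 1 ψ.symm (ψ 1) :=
    contMDiffOn_chart_symm.contMDiffAt (ψ.open_target.mem_nhds (ψ.map_source h1))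
  have hψ : ContMDiffAt 𝓘(ℝ, E) 𝓘(ℝ, E) 1 ψ 1 :=
    contMDiffOn_chart.contMDiffAt (ψ.open_source.mem_nhds h1)
  have hfst : ContMDiffAt 𝓘(ℝ, E × E) 𝓘(ℝ, E) 1 (Prod.fst : E × E → E) (ψ 1, ψ 1) :=
    contDiff_fst.contMDiff.contMDiffAt
  have hsnd : ContMDiffAt 𝓘(ℝ, E × E) 𝓘(ℝ, E) 1 (Prod.snd : E × E → E) (ψ 1, ψ 1) :=
    contDiff_snd.contMDiff.contMDiffAt
  have hmul := (ContMDiffAt.comp (ψ 1, ψ 1) hsymm hfst).mul (ContMDiffAt.comp (ψ 1, ψ 1) hsymm hsnd)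
  refine ContMDiffAt.comp (g := ψ) (ψ 1, ψ 1) ?_ hmul
  simpa [ψ.left_inv h1] using hψ

variable [Bundle.RiemannianBundle (fun x : G ↦ TangentSpace 𝓘(ℝ, E) x)] {Λ : Subgroup G}

/-- Right translation by `l` carries a nearly minimizing path to one of the same length. -/
theorem IsRightInvariantMetric.riemannianEDist_mul_right_le
    (h : IsRightInvariantMetric (E := E) Λ) {l : G} (hl : l ∈ Λ) (x y : G) :
    riemannianEDist 𝓘(ℝ, E) (x * l) (y * l) ≤ riemannianEDist 𝓘(ℝ, E) x y := by
  refine le_of_forall_gt fun r hr ↦ ?_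
  obtain ⟨γ, h0, h1, hγ, hlt, -⟩ := exists_lt_locally_constant_of_riemannianEDist_lt hr zero_lt_one
  have hR : ContMDiff 𝓘(ℝ, E) 𝓘(ℝ, E) 1 (fun y : G ↦ y * l) :=
    (contMDiff_mul_right (I := 𝓘(ℝ, E)) (n := ∞) (a := l)).of_le (by simp)
  refine (riemannianEDist_le_pathELength (γ := fun t ↦ γ t * l) (hR.comp hγ).contMDiffOn
    (by simp [h0]) (by simp [h1]) zero_le_one).trans_lt (lt_of_eq_of_lt ?_ hlt)
  rw [pathELength_eq_lintegral_mfderiv_Icc, pathELength_eq_lintegral_mfderiv_Icc]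
  congr 1 with t
  have hcomp := mfderiv_comp t (hR.mdifferentiable one_ne_zero (γ t))
    (hγ.mdifferentiable one_ne_zero t)
  have : mfderiv 𝓘(ℝ, ℝ) 𝓘(ℝ, E) (fun t ↦ γ t * l) t
    = (mfderiv 𝓘(ℝ, E) 𝓘(ℝ, E) (fun y : G ↦ y * l) (γ t)).comp
      (mfderiv 𝓘(ℝ, ℝ) 𝓘(ℝ, E) γ t) := hcomp
  rw [this, ← ofReal_norm, ← ofReal_norm]
  congr 1
  exact h l hl (γ t) _

theorem IsRightInvariantMetric.riemannianEDist_mul_right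
    (h : IsRightInvariantMetric (E := E) Λ) {l : G} (hl : l ∈ Λ) (x y : G) :
    riemannianEDist 𝓘(ℝ, E) (x * l) (y * l) = riemannianEDist 𝓘(ℝ, E) x y := by
  refine (h.riemannianEDist_mul_right_le hl x y).antisymm ?_
  simpa using h.riemannianEDist_mul_right_le (Λ.inv_mem hl) (x * l) (y * l)

omit [LieGroup 𝓘(ℝ, E) ∞ G] in
theorem quotientRiemannianEDist_mk_le (x y : G) :
    quotientRiemannianEDist E Λ x y ≤ riemannianEDist 𝓘(ℝ, E) x y := by
  rw [quotientRiemannianEDist]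
  exact iInf₂_le_of_le x rfl (iInf₂_le_of_le y rfl le_rfl)

omit [LieGroup 𝓘(ℝ, E) ∞ G] in
theorem quotientRiemannianEDist_self (p : G ⧸ Λ) : quotientRiemannianEDist E Λ p p = 0 := by
  induction p using QuotientGroup.induction_on with
  | H g => exact le_bot_iff.1 ((quotientRiemannianEDist_mk_le g g).trans riemannianEDist_self.le)

variable [IsContMDiffRiemannianBundle 𝓘(ℝ, E) ∞ E (fun x : G ↦ TangentSpace 𝓘(ℝ, E) x)]
  [CompactSpace (G ⧸ Λ)]

theorem eventually_quotientRiemannianEDist_smul_lt {δ : ℝ≥0∞} (hδ : 0 < δ) :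
    ∀ᶠ u in 𝓝 (1 : G), ∀ p : G ⧸ Λ, quotientRiemannianEDist E Λ (u • p) p < δ := by
  have : IsTopologicalGroup G := topologicalGroup_of_lieGroup 𝓘(ℝ, E) ∞
  have : IsManifold 𝓘(ℝ, E) ∞ G := inferInstance
  have : IsManifold 𝓘(ℝ, E) 1 G := inferInstance
  have : IsContinuousRiemannianBundle E (fun x : G ↦ TangentSpace 𝓘(ℝ, E) x) :=
    IsContMDiffRiemannianBundle.isContinuousRiemannianBundle 𝓘(ℝ, E) ∞ E _
  have h := eventually_forall_of_compactSpace_quotient Λ (l := 𝓝 (1 : G))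
    (P := fun u g ↦ quotientRiemannianEDist E Λ ((u * g : G) : G ⧸ Λ) (g : G ⧸ Λ) < δ) ?_ ?_
  · filter_upwards [h] with u hu p
    induction p using QuotientGroup.induction_on with
    | H g => exact hu g
  · intro u g x hx h
    rwa [← mul_assoc, QuotientGroup.mk_mul_of_mem _ hx, QuotientGroup.mk_mul_of_mem _ hx] at h
  · intro g
    have hg := eventually_riemannianEDist_lt 𝓘(ℝ, E) g (ENNReal.half_pos hδ.ne')
    rw [← nhds_prod_eq]
    have hc : Tendsto (fun p : G × G ↦ p.1 * p.2) (𝓝 (1, g)) (𝓝 g) := by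
      simpa using (continuous_mul (M := G)).tendsto (1, g)
    filter_upwards [hc.eventually hg, continuous_snd.continuousAt.eventually hg] with p hp1 hp2
    calc quotientRiemannianEDist E Λ ((p.1 * p.2 : G) : G ⧸ Λ) (p.2 : G ⧸ Λ)
        ≤ riemannianEDist 𝓘(ℝ, E) (p.1 * p.2) p.2 := quotientRiemannianEDist_mk_le _ _
      _ ≤ riemannianEDist 𝓘(ℝ, E) (p.1 * p.2) g + riemannianEDist 𝓘(ℝ, E) g p.2 :=
        riemannianEDist_triangle
      _ < δ / 2 + δ / 2 := by
        rw [riemannianEDist_comm (x := p.1 * p.2)]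
        exact ENNReal.add_lt_add hp1 hp2
      _ = δ := ENNReal.add_halves δ

/-- For representatives `x`, `y` of `p`, `q`, both `y * x⁻¹` and the distance in `G` are unchanged
when `x` and `y` are multiplied on the right by the same element of `Λ`, so a local comparison at
each point becomes uniform. -/
theorem IsRightInvariantMetric.exists_forall_quotientRiemannianEDist_lt
    (hmetric : IsRightInvariantMetric (E := E) Λ) {U : Set G} (hU : U ∈ 𝓝 (1 : G)) :
    ∃ ε : ℝ, 0 < ε ∧ ∀ p q : G ⧸ Λ, quotientRiemannianEDist E Λ q p < ENNReal.ofReal ε →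
      ∃ u ∈ U, q = u • p := by
  have : IsTopologicalGroup G := topologicalGroup_of_lieGroup 𝓘(ℝ, E) ∞
  have : IsManifold 𝓘(ℝ, E) ∞ G := inferInstance
  have : IsManifold 𝓘(ℝ, E) 1 G := inferInstance
  have : IsContinuousRiemannianBundle E (fun x : G ↦ TangentSpace 𝓘(ℝ, E) x) :=
    IsContMDiffRiemannianBundle.isContinuousRiemannianBundle 𝓘(ℝ, E) ∞ E _
  have h := eventually_forall_of_compactSpace_quotient Λ (l := 𝓝[>] (0 : ℝ))
    (P := fun ε x ↦ ∀ y, riemannianEDist 𝓘(ℝ, E) x y < ENNReal.ofReal ε → y * x⁻¹ ∈ U) ?_ ?_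
  · obtain ⟨ε, hε, hε0⟩ := (h.and self_mem_nhdsWithin).exists
    refine ⟨ε, hε0, fun p q hpq ↦ ?_⟩
    simp only [quotientRiemannianEDist, iInf_lt_iff] at hpq
    obtain ⟨y, rfl, x, rfl, hxy⟩ := hpq
    rw [riemannianEDist_comm] at hxy
    refine ⟨y * x⁻¹, hε x y hxy, ?_⟩
    rw [MulAction.Quotient.smul_coe, smul_eq_mul, inv_mul_cancel_right]
  · intro ε x l hl h y hy
    have := h (y * l) (by rwa [hmetric.riemannianEDist_mul_right hl])
    simpa [mul_assoc] using this
  · intro g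
    have hd : ∀ᶠ p : G × G in 𝓝 g ×ˢ 𝓝 g, p.2 * p.1⁻¹ ∈ U := by
      rw [← nhds_prod_eq]
      exact (continuous_snd.mul continuous_fst.inv).continuousAt.preimage_mem_nhds (by simpa using hU)
    obtain ⟨W, hW, hWU⟩ := eventually_prod_self_iff (r := fun x y ↦ y * x⁻¹ ∈ U).1 hd
    obtain ⟨c, hc, hcW⟩ := setOfPred_riemannianEDist_lt_subset_nhds' 𝓘(ℝ, E) hW
    have hε : ∀ᶠ ε in 𝓝[>] (0 : ℝ), ENNReal.ofReal ε < c / 2 := by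
      refine nhdsWithin_le_nhds ((ENNReal.continuous_ofReal.tendsto 0).eventually_lt_const ?_)
      simpa using hc.ne'
    have hg := eventually_riemannianEDist_lt 𝓘(ℝ, E) g (ENNReal.half_pos hc.ne')
    filter_upwards [hε.prod_mk hg] with p hp y hy
    refine hWU _ (hcW (hp.2.trans_le ENNReal.half_le_self)) _ (hcW ?_)
    calc riemannianEDist 𝓘(ℝ, E) g y
        ≤ riemannianEDist 𝓘(ℝ, E) g p.2 + riemannianEDist 𝓘(ℝ, E) p.2 y := riemannianEDist_triangle
      _ < c / 2 + c / 2 := ENNReal.add_lt_add hp.2 (hy.trans hp.1)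
      _ = c := ENNReal.add_halves c

end Riemannian

/-! ### Close orbits in the quotient come from orbits near the identity in the group. -/

section Endomorphism

open Filter Topology

variable {G : Type*} [TopologicalSpace G] [Group G] [IsTopologicalGroup G] {Λ : Subgroup G}
  {φ : G ⧸ Λ → G ⧸ Λ} {F : G →* G}

omit [TopologicalSpace G] [IsTopologicalGroup G] in
theorem iterate_smul_of_semiconj (hφ : ∀ (h : G) (p : G ⧸ Λ), φ (h • p) = F h • φ p) (n : ℕ)
    (h : G) (p : G ⧸ Λ) : φ^[n] (h • p) = F^[n] h • φ^[n] p := by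
  induction n with
  | zero => rfl
  | succ n ih => simp only [Function.iterate_succ_apply', ih, hφ]

/-- For a discrete cocompact `Λ`, if the orbits of `x` and `y` stay close, in the sense that they
differ by the action of small elements of `G`, then these elements form an `F`-orbit. -/
theorem exists_nhds_orbit [DiscreteTopology Λ] [CompactSpace (G ⧸ Λ)] (hF : Continuous F)
    (hφ : ∀ (h : G) (p : G ⧸ Λ), φ (h • p) = F h • φ p) {U : Set G} (hU : U ∈ 𝓝 (1 : G)) :
    ∃ U' ∈ 𝓝 (1 : G), ∀ (n : ℕ) (x y : G ⧸ Λ),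
      (∀ i ≤ n, ∃ u ∈ U', φ^[i] y = u • φ^[i] x) →
      ∃ h, y = h • x ∧ ∀ i ≤ n, F^[i] h ∈ U := by
  have hd : ∀ᶠ p : G × G in 𝓝 1 ×ˢ 𝓝 1, ∀ q : G ⧸ Λ, (p.1⁻¹ * p.2) • q = q → p.1⁻¹ * p.2 = 1 := by
    rw [← nhds_prod_eq]
    have hc : Tendsto (fun p : G × G ↦ p.1⁻¹ * p.2) (𝓝 (1, 1)) (𝓝 1) := by
      have : Continuous fun p : G × G ↦ p.1⁻¹ * p.2 := continuous_fst.inv.mul continuous_snd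
      simpa using this.tendsto (1, 1)
    exact hc.eventually (eventually_smul_injective Λ)
  obtain ⟨W, hW, hWinj⟩ := eventually_prod_self_iff
    (r := fun u v ↦ ∀ q : G ⧸ Λ, (u⁻¹ * v) • q = q → u⁻¹ * v = 1).1 hd
  have hFW : F ⁻¹' W ∈ 𝓝 (1 : G) := hF.continuousAt.preimage_mem_nhds (by simpa using hW)
  -- Both `F (u i)` and `u (i + 1)` must lie in `W`, where elements with the same effect on one
  -- point coincide.
  refine ⟨U ∩ (W ∩ F ⁻¹' W), inter_mem hU (inter_mem hW hFW), fun n x y h ↦ ?_⟩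
  choose! u hu hyu using h
  have key : ∀ i ≤ n, F^[i] (u 0) = u i := by
    intro i
    induction i with
    | zero => intro _; rfl
    | succ i ih =>
      intro hi
      have hi' : i ≤ n := by omega
      rw [Function.iterate_succ_apply', ih hi']
      have h1 : F (u i) • φ^[i + 1] x = u (i + 1) • φ^[i + 1] x := by
        rw [← hyu _ hi, Function.iterate_succ_apply', Function.iterate_succ_apply', hyu i hi', hφ]
      refine (inv_mul_eq_one.1 (hWinj _ (hu _ hi).2.1 _ (hu i hi').2.2 (φ^[i + 1] x) ?_)).symm
      rw [mul_smul, h1, inv_smul_smul]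
  exact ⟨u 0, hyu 0 n.zero_le, fun i hi ↦ key i hi ▸ (hu i hi).1⟩

end Endomorphism

/-! ### Assembly of the theorem. -/

theorem mainTheorem9
    {E : Type*} [NormedAddCommGroup E] [NormedSpace ℝ E] [FiniteDimensional ℝ E]
    {G : Type*} [TopologicalSpace G] [T2Space G] [ChartedSpace E G] [Group G]
    [LieGroup 𝓘(ℝ, E) ∞ G]
    [Bundle.RiemannianBundle (fun x : G ↦ TangentSpace 𝓘(ℝ, E) x)]
    [IsContMDiffRiemannianBundle 𝓘(ℝ, E) ∞ E (fun x : G ↦ TangentSpace 𝓘(ℝ, E) x)]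
    (Λ : Subgroup G) [DiscreteTopology Λ] [CompactSpace (G ⧸ Λ)]
    (hmetric : IsRightInvariantMetric (E := E) Λ)
    (φ : G ⧸ Λ → G ⧸ Λ) (hφ : IsHomogeneousEndomorphism E Λ φ) :
    IsHExpansive (quotientRiemannianEDist E Λ) φ := by
  classical
  have : IsTopologicalGroup G := topologicalGroup_of_lieGroup 𝓘(ℝ, E) ∞
  have : CompleteSpace E := FiniteDimensional.complete ℝ E
  obtain ⟨a, Φ, hΦ, -, hφ⟩ := hφ
  set F : G →* G := (MulAut.conj a).toMonoidHom.comp Φ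
  have hFc : Continuous F := (continuous_const.mul hΦ.continuous).mul continuous_const
  have hsemi : ∀ (h : G) (p : G ⧸ Λ), φ (h • p) = F h • φ p := by
    intro h p
    induction p using QuotientGroup.induction_on with
    | H g =>
      rw [hφ g, MulAction.Quotient.smul_coe, MulAction.Quotient.smul_coe, smul_eq_mul, hφ]
      simp [F, mul_assoc]
  obtain ⟨r, L, hψ⟩ := exists_isLocalScale_chartAt (E := E) (G := G)
  obtain ⟨U, hU, hcover⟩ := hψ.exists_finset_cover hFc
  obtain ⟨U', hU', horbit⟩ := exists_nhds_orbit hFc hsemi hU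
  obtain ⟨ε, hε, hclose⟩ := hmetric.exists_forall_quotientRiemannianEDist_lt hU'
  refine ⟨ε, hε, tailEntropy_eq_zero_of_spanNumber_le quotientRiemannianEDist_self hε
    fun δ hδ ↦ ?_⟩
  obtain ⟨N, hN⟩ := hcover _ (eventually_quotientRiemannianEDist_smul_lt (E := E) (Λ := Λ)
    (ENNReal.ofReal_pos.2 hδ))
  refine ⟨N, ?_⟩
  filter_upwards [Filter.eventually_gt_atTop 0] with n hn x
  -- Times `i < n + 1` in the entropy become `i ≤ n` in the orbit sets.
  obtain ⟨n, rfl⟩ := Nat.exists_eq_succ_of_ne_zero hn.ne'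
  obtain ⟨K, hK, hKcover⟩ := hN n
  refine spanNumber_le_card (K.image (· • x)) (Finset.card_image_le.trans hK) fun y hy ↦ ?_
  obtain ⟨h, rfl, hh⟩ := horbit n x y fun i hi ↦ hclose _ _ (hy i (Nat.lt_succ_of_le hi))
  obtain ⟨k, hk, hkV⟩ := hKcover h hh
  refine ⟨k • x, by simpa using ⟨k, hk, rfl⟩, fun i hi ↦ ?_⟩
  -- Writing `h = (h * k⁻¹) * k` gives `φ^[i] (h • x) = F^[i] (h * k⁻¹) • φ^[i] (k • x)`, a
  -- displacement smaller than `δ`.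
  have := hkV i (Nat.le_of_lt_succ hi) (φ^[i] (k • x))
  rwa [← iterate_smul_of_semiconj hsemi, smul_smul, inv_mul_cancel_right] at this
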